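/- Let $n \ge 2$. For $0 \le k \le n$ put $a_k = 0$ if $k$ is odd and $$a_k = (-1)^{k/2} \prod_{i=0}^{k/2-1} \frac{2i+1}{n-2i-1}$$ if $k$ is even. Let $d_{\max} = \lfloor n/2 \rfloor$, and let $Y^{(n)}$ be the real matrix whose rows and columns are indexed by the subsets of $[n] = \{1,\dots,n\}$ with at most $d_{\max}$ elements and whose entries are $Y^{(n)}_{S,T} = a_{|S \triangle T|}$, where $\triangle$ is the symmetric difference. Then: 1. $Y^{(n)}$ is positive semidefinite. 2. If $n$ is odd, then the sum-of-squares relaxation of degree $n-1$ does not exactly represent the hypercube $\{\pm 1\}^n$. Here a degree $2d$ pseudoexpectation is a linear functional $\widetilde{\mathbb{E}}$ on the real polynomials in $x_1,\dots,x_n$ of degree at most $2d$ with $\widetilde{\mathbb{E}}[1] = 1$, with $\widetilde{\mathbb{E}}[(x_i^2-1)p] = 0$ for all $i \in [n]$ and all $p$ of degree at most $2d-2$, and with $\widetilde{\mathbb{E}}[p^2] \ge 0$ for all $p$ of degree at most $d$. Precisely, there is a degree $n-1 = 2 d_{\max}$ pseudoexpectation $\widetilde{\mathbb{E}}$ such that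 - its pseudomoment matrix is $Y^{(n)}$, that is, $\widetilde{\mathbb{E}}\bigl[\prod_{i \in S} x_i \prod_{j \in T} x_j\bigr] = a_{|S \triangle T|}$ whenever $|S|, |T| \le d_{\max}$; - $\widetilde{\mathbb{E}}$ is not the expectation functional (on polynomials of degree at most $n-1$) of any probability measure on $\{\pm 1\}^n$; - there is a polynomial $p$ of degree at most $n-1$ with $\max_{x \in \{\pm 1\}^n} p(x) < \widetilde{\mathbb{E}}[p]$. -/

import Mathlib

namespace GrigorievLaurent

noncomputable section

/-- The constants `a_k` (for a given `n`): zero for odd `k`, and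
`(-1)^(k/2) * ∏_{i=0}^{k/2-1} (2i+1)/(n-2i-1)` for even `k`. -/
def a (n k : ℕ) : ℝ :=
  if Even k then
    (-1 : ℝ) ^ (k / 2) *
      ∏ i ∈ Finset.range (k / 2), (2 * (i : ℝ) + 1) / ((n : ℝ) - 2 * (i : ℝ) - 1)
  else 0

/-- `d_max(n) = ⌊n/2⌋` (natural-number division rounds down). -/
def dMax (n : ℕ) : ℕ := n / 2

/-- The subsets of `[n]` with at most `d` elements. -/
abbrev SubsetLE (n d : ℕ) : Type := {S : Finset (Fin n) // S.card ≤ d}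

/-- The Grigoriev–Laurent pseudomoment matrix `Y^(n)`, indexed by the subsets of `[n]` of
size at most `d_max(n)`, with entries `a_{|S △ T|}`. -/
def Y (n : ℕ) : Matrix (SubsetLE n (dMax n)) (SubsetLE n (dMax n)) ℝ :=
  Matrix.of fun S T => a n (symmDiff S.1 T.1).card

/-- `ℝ[x_1, …, x_n]_{≤ D}`, the polynomials of total degree at most `D`. -/
abbrev PolyLE (n D : ℕ) : Submodule ℝ (MvPolynomial (Fin n) ℝ) :=
  MvPolynomial.restrictTotalDegree (Fin n) ℝ D

/-- The monomial `x^S = ∏_{i ∈ S} x_i`. -/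
def mono {n : ℕ} (S : Finset (Fin n)) : MvPolynomial (Fin n) ℝ :=
  ∏ i ∈ S, MvPolynomial.X i

theorem one_mem_polyLE (n D : ℕ) : (1 : MvPolynomial (Fin n) ℝ) ∈ PolyLE n D := by
  rw [MvPolynomial.mem_restrictTotalDegree]
  simp

theorem constraint_mul_mem_polyLE {n d : ℕ} (i : Fin n) (p : MvPolynomial (Fin n) ℝ)
    (hp : p.totalDegree + 2 ≤ 2 * d) :
    (MvPolynomial.X i ^ 2 - 1) * p ∈ PolyLE n (2 * d) := by
  rw [MvPolynomial.mem_restrictTotalDegree]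
  refine (MvPolynomial.totalDegree_mul _ _).trans ?_
  have h1 : (MvPolynomial.X i ^ 2 - 1 : MvPolynomial (Fin n) ℝ).totalDegree ≤ 2 := by
    refine (MvPolynomial.totalDegree_sub _ _).trans ?_
    refine max_le ?_ (by simp)
    exact (MvPolynomial.totalDegree_X_pow i 2).le
  omega

theorem sq_mem_polyLE {n d : ℕ} (p : MvPolynomial (Fin n) ℝ) (hp : p.totalDegree ≤ d) :
    p ^ 2 ∈ PolyLE n (2 * d) := by
  rw [MvPolynomial.mem_restrictTotalDegree]
  exact (MvPolynomial.totalDegree_pow p 2).trans (Nat.mul_le_mul_left 2 hp)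

theorem totalDegree_mono_le {n : ℕ} (S : Finset (Fin n)) :
    (mono S).totalDegree ≤ S.card := by
  refine (MvPolynomial.totalDegree_finsetProd _ _).trans ?_
  simp

theorem mono_mul_mono_mem_polyLE {n d : ℕ} (S T : SubsetLE n d) :
    mono S.1 * mono T.1 ∈ PolyLE n (2 * d) := by
  rw [MvPolynomial.mem_restrictTotalDegree]
  refine (MvPolynomial.totalDegree_mul _ _).trans ?_
  have hS := (totalDegree_mono_le S.1).trans S.2
  have hT := (totalDegree_mono_le T.1).trans T.2
  omega

/-- A degree `2d` pseudoexpectation over `{±1}^n`: a linear functional `E` on the polynomials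
of degree at most `2d` with `E[1] = 1`, `E[(x_i^2 - 1) p] = 0` for `deg p ≤ 2d - 2`, and
`E[p^2] ≥ 0` for `deg p ≤ d`. -/
structure IsPseudoexpectation {n d : ℕ} (E : PolyLE n (2 * d) →ₗ[ℝ] ℝ) : Prop where
  map_one : E ⟨1, one_mem_polyLE n (2 * d)⟩ = 1
  map_constraint : ∀ (i : Fin n) (p : MvPolynomial (Fin n) ℝ)
    (hp : p.totalDegree + 2 ≤ 2 * d),
    E ⟨(MvPolynomial.X i ^ 2 - 1) * p, constraint_mul_mem_polyLE i p hp⟩ = 0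
  map_sq_nonneg : ∀ (p : MvPolynomial (Fin n) ℝ) (hp : p.totalDegree ≤ d),
    0 ≤ E ⟨p ^ 2, sq_mem_polyLE p hp⟩

/-- The pseudomoment matrix of a functional `E` on the polynomials of degree at most `2d`:
its entries are `E[x^S x^T]` for `|S|, |T| ≤ d`. -/
def pseudomomentMatrix {n d : ℕ} (E : PolyLE n (2 * d) →ₗ[ℝ] ℝ) :
    Matrix (SubsetLE n d) (SubsetLE n d) ℝ :=
  Matrix.of fun S T => E ⟨mono S.1 * mono T.1, mono_mul_mono_mem_polyLE S T⟩

/-- The hypercube `{±1}^n` as a subset of `ℝ^n`. -/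
def hypercube (n : ℕ) : Set (Fin n → ℝ) := {x | ∀ i, x i = 1 ∨ x i = -1}

/-- The expectation `E_μ[p]` of a polynomial under a measure on the hypercube. -/
def expectation {n : ℕ} (μ : MeasureTheory.Measure (hypercube n))
    (p : MvPolynomial (Fin n) ℝ) : ℝ :=
  ∫ x : hypercube n, MvPolynomial.eval x.1 p ∂μ

/-- For odd `n`, the degree `2 * d_max(n)` is `n - 1`. -/
theorem two_mul_dMax_of_odd {n : ℕ} (hn : Odd n) : 2 * dMax n = n - 1 := by
  obtain ⟨m, rfl⟩ := hn
  simp only [dMax]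
  omega

end

end GrigorievLaurent

/-!
Write `E` for the functional `x^S ↦ a_{|S|}`; it behaves like the expectation under a distribution
on the hypercube with `x_1 + ⋯ + x_n = 0`, which exists only for even `n`.

Positive semidefiniteness of `Y^(n)` is proved for both parities at once, by passing from `n` to
`n - 2`. Let `w` be an eigenvector of a negative eigenvalue, viewed as a polynomial of degree at
most `n / 2`, and let `σ` be the transposition of two variables `x`, `y`. As `Y^(n)` commutes with
`σ`, the difference `w - w ∘ σ` is zero or again an eigenvector of that eigenvalue. But
`w - w ∘ σ = (x - y) g`, with `g` of degree at most `n / 2 - 1` in the other variables, and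
`E_n[(x - y)² g²] = 2 E_n[(1 - x y) g²]` is a positive multiple of `E_{n-2}[g²] ≥ 0`
(`a_sub_a_add_two`, `momentMatrix_nonneg_of_antisymm`). Hence `w = w ∘ σ` for all transpositions
(`posSemidef_of_perm`), so `w` is a symmetric polynomial. Because `E` kills the multiples of
`x_1 + ⋯ + x_n` in the degrees at hand, a symmetric polynomial acts as a constant
(`esymmMoment_eq`), and the form at `w` is a square (`momentMatrix_nonneg_of_invariant`), a
contradiction.

For odd `n`, the functional that sends a monomial to `a_k`, with `k` the number of odd exponents,
is the required pseudoexpectation. It sends `-(x_1 + ⋯ + x_n)²` to `0`, although a sum of an odd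
number of signs is never zero, so that this polynomial is at most `-1` on the hypercube.
-/

namespace GrigorievLaurent

open Finset Matrix

/-! ### The constants `a_k` -/

theorem a_zero (n : ℕ) : a n 0 = 1 := by simp [a]

theorem a_of_odd (n : ℕ) {k : ℕ} (hk : Odd k) : a n k = 0 := by
  simp [a, Nat.not_even_iff_odd.2 hk]

/-- No bound on `k` is needed: for `k + 1 = n` both sides vanish, by `x / 0 = 0`. -/
theorem a_add_two (n k : ℕ) :
    a n (k + 2) = -(((k : ℝ) + 1) / ((n : ℝ) - k - 1)) * a n k := by
  rcases Nat.even_or_odd k with ⟨j, rfl⟩ | hk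
  · have h1 : (j + j + 2) / 2 = j + 1 := by omega
    have h2 : (j + j) / 2 = j := by omega
    have h3 : Even (j + j + 2) := ⟨j + 1, by ring⟩
    simp only [a, h1, h2, h3, if_true, Finset.prod_range_succ, pow_succ, Even.add_self]
    push_cast
    ring
  · rw [a_of_odd n hk, a_of_odd n (hk.add_even even_two), mul_zero]

/-- The relation `E[(x_1 + ⋯ + x_n) x^S] = 0` in terms of the moments, for `|S| = k < n`. -/
theorem mul_a_pred_add_mul_a_succ {n k : ℕ} (hk : k < n) :
    (k : ℝ) * a n (k - 1) + ((n : ℝ) - k) * a n (k + 1) = 0 := by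
  rcases k with _ | k
  · simp [a_of_odd n odd_one]
  · have h : (n : ℝ) - k - 1 ≠ 0 := by
      have : (k : ℝ) + 1 < n := by exact_mod_cast hk
      intro h; linarith
    rw [a_add_two, Nat.add_sub_cancel]
    push_cast
    field_simp
    ring

/-- `E_{n+2}[x^S]` and `E_n[x^S]` are proportional for each fixed `|S| = k ≤ n`. -/
theorem mul_a_add_two_left {n k : ℕ} (hk : k ≤ n) :
    ((n : ℝ) + 1) * a (n + 2) k = ((n : ℝ) + 1 - k) * a n k := by
  induction k using Nat.twoStepInduction with
  | zero => simp [a_zero]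
  | one => simp [a_of_odd _ odd_one]
  | more k ih _ =>
    have hk' : (k : ℝ) + 2 ≤ n := by exact_mod_cast hk
    have ih := ih (by omega)
    have h1 : (n : ℝ) - k - 1 ≠ 0 := by intro h; linarith
    have h2 : ((n + 2 : ℕ) : ℝ) - k - 1 ≠ 0 := by push_cast; intro h; linarith
    rw [a_add_two, a_add_two]
    have e : ((n + 2 : ℕ) : ℝ) - k - 1 = (n : ℝ) + 1 - k := by push_cast; ring
    rw [e] at h2 ⊢
    calc _ = -(((k : ℝ) + 1) / ((n : ℝ) + 1 - k)) * (((n : ℝ) + 1) * a (n + 2) k) := by ring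
      _ = _ := by
        rw [ih]
        push_cast
        field_simp
        ring

/-- Conditioning on `x_a = -x_b` turns the moments for `n + 2` variables into those for `n`
variables: `E_{n+2}[(1 - x_a x_b) q]` is a positive multiple of `E_n[q]` for every `q` in the
remaining variables. -/
theorem a_sub_a_add_two {n k : ℕ} (hk : k ≤ n) :
    a (n + 2) k - a (n + 2) (k + 2) = ((n : ℝ) + 2) / ((n : ℝ) + 1) * a n k := by
  have hk' : (k : ℝ) ≤ n := by exact_mod_cast hk
  have h := mul_a_add_two_left hk
  have h1 : (n : ℝ) + 1 - k ≠ 0 := by intro h; linarith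
  have h2 : (n : ℝ) + 1 ≠ 0 := by positivity
  rw [a_add_two]
  have e : ((n + 2 : ℕ) : ℝ) - k - 1 = (n : ℝ) + 1 - k := by push_cast; ring
  rw [e]
  have h3 : a n k = ((n : ℝ) + 1) * a (n + 2) k / ((n : ℝ) + 1 - k) := by
    rw [h]; field_simp
  rw [h3]
  field_simp
  ring

/-! ### Positivity from a group of symmetries -/

/-- A symmetric matrix that commutes with a set of permutations is positive semidefinite as soon
as its quadratic form is nonnegative on the differences `w - w ∘ σ` and on the invariant vectors:
an eigenvector `w` of a negative eigenvalue would satisfy `w = w ∘ σ` for every `σ`, since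
`w - w ∘ σ` lies in the same eigenspace. -/
theorem posSemidef_of_perm {ι : Type*} [Fintype ι] [DecidableEq ι] {M : Matrix ι ι ℝ}
    (hM : M.IsHermitian) (G : Set (Equiv.Perm ι)) (hG : ∀ σ ∈ G, ∀ i j, M (σ i) (σ j) = M i j)
    (hdiff : ∀ w : ι → ℝ, ∀ σ ∈ G, 0 ≤ (w - w ∘ σ) ⬝ᵥ M *ᵥ (w - w ∘ σ))
    (hinv : ∀ w : ι → ℝ, (∀ σ ∈ G, w ∘ σ = w) → 0 ≤ w ⬝ᵥ M *ᵥ w) : M.PosSemidef := by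
  rw [hM.posSemidef_iff_eigenvalues_nonneg]
  intro i
  by_contra hneg
  have hneg : hM.eigenvalues i < 0 := not_le.1 hneg
  set w : ι → ℝ := (hM.eigenvectorBasis i).ofLp with hw
  have hev : M *ᵥ w = hM.eigenvalues i • w := hM.mulVec_eigenvectorBasis i
  have hzero : ∀ u : ι → ℝ, M *ᵥ u = hM.eigenvalues i • u → 0 ≤ u ⬝ᵥ M *ᵥ u → u = 0 := by
    intro u hu h
    rw [hu, dotProduct_smul, smul_eq_mul] at h
    have h1 : 0 ≤ u ⬝ᵥ u := by
      simpa [dotProduct] using Finset.sum_nonneg fun i _ => mul_self_nonneg (u i)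
    exact dotProduct_self_eq_zero.1 (by nlinarith)
  have hw0 : w = 0 := by
    refine hzero w hev (hinv w fun σ hσ => ?_)
    have hσw : M *ᵥ (w ∘ σ) = hM.eigenvalues i • (w ∘ σ) := by
      ext j
      have := congrFun hev (σ j)
      simp only [mulVec, dotProduct, Pi.smul_apply, Function.comp] at this ⊢
      rw [← this, ← Equiv.sum_comp σ (fun k => M (σ j) k * w k)]
      simp only [hG σ hσ]
    refine (sub_eq_zero.1 (hzero _ ?_ (hdiff w σ hσ))).symm
    rw [mulVec_sub, hev, hσw, smul_sub]
  apply (hM.eigenvectorBasis.orthonormal.ne_zero i)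
  ext j
  exact congrFun hw0 j

/-! ### Elementary symmetric polynomials in pseudoexpectation -/

section ElementarySymmetric

variable {α : Type*} [DecidableEq α]

theorem card_symmDiff_singleton_of_mem {S : Finset α} {i : α} (h : i ∈ S) :
    #(symmDiff {i} S) = #S - 1 := by
  have : symmDiff {i} S = S.erase i := by
    ext x; simp only [mem_symmDiff, mem_singleton, mem_erase]; grind
  rw [this, card_erase_of_mem h]

theorem card_symmDiff_singleton_of_notMem {S : Finset α} {i : α} (h : i ∉ S) :
    #(symmDiff {i} S) = #S + 1 := by
  have : symmDiff {i} S = insert i S := by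
    ext x; simp only [mem_symmDiff, mem_singleton, mem_insert]; grind
  rw [this, card_insert_of_notMem h]

theorem sum_comp_card_symmDiff_singleton {A S : Finset α} (hS : S ⊆ A) (f : ℕ → ℝ) :
    ∑ i ∈ A, f #(symmDiff {i} S) = #S * f (#S - 1) + ((#A : ℝ) - #S) * f (#S + 1) := by
  rw [← sum_sdiff hS, sum_congr rfl fun i hi => by
      rw [card_symmDiff_singleton_of_notMem (mem_sdiff.1 hi).2],
    sum_congr (s₁ := S) rfl fun i hi => by rw [card_symmDiff_singleton_of_mem hi]]
  simp only [sum_const, nsmul_eq_mul, card_sdiff_of_subset hS, Nat.cast_sub (card_le_card hS)]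
  ring

/-- `E[e_k x^T]`, where `e_k` is the elementary symmetric polynomial in the variables of `A`. -/
noncomputable def esymmMoment (A : Finset α) (k : ℕ) (T : Finset α) : ℝ :=
  ∑ S ∈ A.powersetCard k, a #A #(symmDiff S T)

/-- The relation `(k + 2) e_{k+2} + (n - k) e_k = e_1 e_{k+1}` modulo `x_i² = 1`, together with
the vanishing of `E` on the multiples of `e_1`. -/
theorem esymmMoment_add_two {A T : Finset α} (hT : T ⊆ A) {k : ℕ} (hk : k + 1 + #T < #A) :
    ((k : ℝ) + 2) * esymmMoment A (k + 2) T + ((#A : ℝ) - k) * esymmMoment A k T = 0 := by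
  have h1 : ∑ S ∈ A.powersetCard (k + 1), ∑ i ∈ A, a #A #(symmDiff {i} (symmDiff S T)) = 0 := by
    refine sum_eq_zero fun S hS => ?_
    obtain ⟨hSA, hSk⟩ := mem_powersetCard.1 hS
    have hsub : symmDiff S T ⊆ A := by
      intro x hx
      rcases mem_symmDiff.1 hx with h | h
      exacts [hSA h.1, hT h.1]
    rw [sum_comp_card_symmDiff_singleton hsub]
    apply mul_a_pred_add_mul_a_succ
    have : #(symmDiff S T) ≤ #S + #T :=
      (card_le_card (symmDiff_le_sup (a := S) (b := T))).trans (card_union_le S T)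
    omega
  -- The substitution `S ↦ {i} ∆ S` turns the double sum into a single sum over `S`, weighted by
  -- the number of `i` with `#({i} ∆ S) = k + 1`.
  have h2 : ∑ S ∈ A.powersetCard (k + 1), ∑ i ∈ A, a #A #(symmDiff {i} (symmDiff S T)) =
      ∑ S ∈ A.powerset, (∑ i ∈ A, if #(symmDiff {i} S) = k + 1 then (1 : ℝ) else 0) *
        a #A #(symmDiff S T) := by
    rw [sum_comm]
    simp only [sum_mul]
    rw [sum_comm (s := A.powerset)]
    refine sum_congr rfl fun i hi => ?_
    rw [powersetCard_eq_filter, sum_filter]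
    have hmem : ∀ S ∈ A.powerset, symmDiff {i} S ∈ A.powerset := by
      intro S hS
      rw [mem_powerset] at hS ⊢
      intro x hx
      rcases mem_symmDiff.1 hx with h | h
      · rw [mem_singleton.1 h.1]; exact hi
      · exact hS h.1
    refine sum_nbij' (fun S => symmDiff {i} S) (fun S => symmDiff {i} S) hmem hmem
      (fun S _ => symmDiff_symmDiff_cancel_left _ _) (fun S _ => symmDiff_symmDiff_cancel_left _ _)
      fun S _ => ?_
    rw [symmDiff_symmDiff_cancel_left, symmDiff_assoc]
    split_ifs <;> simp
  rw [h1] at h2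
  rw [h2, esymmMoment, esymmMoment, powersetCard_eq_filter, powersetCard_eq_filter,
    sum_filter, sum_filter, mul_sum, mul_sum, ← sum_add_distrib]
  refine sum_congr rfl fun S hS => ?_
  rw [sum_comp_card_symmDiff_singleton (mem_powerset.1 hS)
    fun m => if m = k + 1 then (1 : ℝ) else 0]
  by_cases h3 : #S = k + 2
  · simp [h3]
  have h4 : ¬#S - 1 = k + 1 := by omega
  by_cases h5 : #S = k
  · simp [h5, show ¬k - 1 = k + 1 by omega]
  · simp [h3, h4, h5]

/-- Modulo the multiples of `e_1`, the elementary symmetric polynomial `e_k` is a constant. -/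
theorem esymmMoment_eq {A T : Finset α} (hT : T ⊆ A) {k : ℕ} (hk : k + #T ≤ #A) :
    esymmMoment A k T = esymmMoment A k ∅ * a #A #T := by
  induction k using Nat.twoStepInduction with
  | zero => simp [esymmMoment, a_zero, symmDiff_def]
  | one =>
    have h : ∀ T ⊆ A, 1 + #T ≤ #A → esymmMoment A 1 T = 0 := by
      intro T hT hk
      rw [esymmMoment, powersetCard_one, sum_map]
      exact (sum_comp_card_symmDiff_singleton hT (a #A)).trans
        (mul_a_pred_add_mul_a_succ (by omega))
    rw [h T hT hk, h ∅ (empty_subset _) (by rw [card_empty]; omega), zero_mul]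
  | more k ih _ =>
    have h1 := esymmMoment_add_two hT (k := k) (by omega)
    have h2 := esymmMoment_add_two (empty_subset A) (k := k) (by rw [card_empty]; omega)
    rw [ih (by omega)] at h1
    have h3 : (k : ℝ) + 2 ≠ 0 := by positivity
    apply mul_left_cancel₀ h3
    linear_combination h1 - a #A #T * h2

end ElementarySymmetric

/-! ### Positivity of the pseudomoment matrix -/

section MomentMatrix

theorem card_finsetCongr {α β : Type*} (σ : α ≃ β) (S : Finset α) :
    #(σ.finsetCongr S) = #S := by
  simp

variable {α : Type*} [DecidableEq α]

theorem finsetCongr_swap_subset_iff {A S : Finset α} {x y : α} (hx : x ∈ A) (hy : y ∈ A) :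
    (Equiv.swap x y).finsetCongr S ⊆ A ↔ S ⊆ A := by
  have hA : ∀ z, Equiv.swap x y z ∈ A ↔ z ∈ A := by
    intro z
    rw [Equiv.swap_apply_def]
    split_ifs <;> simp_all
  simp only [Equiv.finsetCongr_apply, subset_iff, mem_map_equiv, Equiv.symm_swap]
  constructor
  · intro h z hz
    exact (hA z).1 (h (by simpa using hz))
  · intro h z hz
    exact (hA z).1 (h hz)

theorem symmDiff_finsetCongr (σ : Equiv.Perm α) (S T : Finset α) :
    symmDiff (σ.finsetCongr S) (σ.finsetCongr T) = σ.finsetCongr (symmDiff S T) := by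
  ext; simp [mem_symmDiff]

/-- Exchanging an element of `S \ T` with one of `T \ S` moves `S` towards `T`. -/
theorem eq_of_card_eq_of_swap_invariant {A : Finset α} {w : Finset α → ℝ}
    (hw : ∀ x ∈ A, ∀ y ∈ A, ∀ S, w ((Equiv.swap x y).finsetCongr S) = w S) {S T : Finset α}
    (hS : S ⊆ A) (hT : T ⊆ A) (h : #S = #T) : w S = w T := by
  induction hm : #(S \ T) using Nat.strong_induction_on generalizing S with
  | _ m ih =>
    by_cases hST : S ⊆ T
    · rw [eq_of_subset_of_card_le hST h.ge]
    · have hTS : ¬ T ⊆ S := fun hTS => hST (eq_of_subset_of_card_le hTS h.le).ge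
      obtain ⟨x, hxS, hxT⟩ := not_subset.1 hST
      obtain ⟨y, hyT, hyS⟩ := not_subset.1 hTS
      rw [← hw x (hS hxS) y (hT hyT) S]
      refine ih _ ?_ ((finsetCongr_swap_subset_iff (hS hxS) (hT hyT)).2 hS) (by simpa using h) rfl
      rw [← hm]
      apply card_lt_card
      refine (ssubset_iff_of_subset ?_).2 ⟨x, by simp [hxS, hxT], by simp [hxT, hyS]⟩
      intro z
      simp only [mem_sdiff, Equiv.finsetCongr_apply, mem_map_equiv, Equiv.symm_swap]
      rintro ⟨h1, h2⟩
      refine ⟨?_, h2⟩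
      rw [Equiv.swap_apply_def] at h1
      split_ifs at h1 with h3 h4
      · exact h3 ▸ hxS
      · exact absurd (h4 ▸ hyT) h2
      · exact h1

/-- A coefficient vector that is antisymmetric under exchanging `x` and `y` is the coefficient
vector of `(x - y) g`, with `g` a polynomial in the remaining variables. -/
theorem sum_powerset_mul_of_antisymm {B : Finset α} {x y : α} (hx : x ∉ insert y B)
    (hy : y ∉ B) {c : Finset α → ℝ} (hc0 : ∀ S ⊆ B, c S = 0)
    (hc2 : ∀ S ⊆ B, c (insert x (insert y S)) = 0)
    (hc1 : ∀ S ⊆ B, c (insert y S) = -c (insert x S)) (f : Finset α → ℝ) :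
    ∑ S ∈ (insert x (insert y B)).powerset, c S * f S =
      ∑ S ∈ B.powerset, c (insert x S) * (f (insert x S) - f (insert y S)) := by
  rw [sum_powerset_insert hx, sum_powerset_insert hy, sum_powerset_insert hy]
  simp only [← sum_add_distrib]
  refine sum_congr rfl fun S hS => ?_
  rw [mem_powerset] at hS
  rw [hc0 S hS, hc1 S hS, hc2 S hS]
  ring

/-- The pseudomoment matrix of the variables in `A`. It is indexed by all subsets of the ambient
type, with zero entries outside the subsets of `A` of size at most `#A / 2`, so that the matrices
for different `A` have the same index type. -/
noncomputable def momentMatrix (A : Finset α) : Matrix (Finset α) (Finset α) ℝ :=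
  Matrix.of fun S T =>
    if (S ⊆ A ∧ 2 * #S ≤ #A) ∧ (T ⊆ A ∧ 2 * #T ≤ #A) then a #A #(symmDiff S T) else 0

/-- The truncation of a coefficient vector to the sets of size at most `#A / 2`. -/
noncomputable def lowPart (A : Finset α) (w : Finset α → ℝ) (S : Finset α) : ℝ :=
  if 2 * #S ≤ #A then w S else 0

theorem momentMatrix_isHermitian (A : Finset α) : (momentMatrix A).IsHermitian := by
  ext S T
  simp only [momentMatrix, conjTranspose_apply, of_apply, star_trivial, symmDiff_comm T S]
  exact if_congr and_comm rfl rfl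

theorem momentMatrix_swap {A : Finset α} {x y : α} (hx : x ∈ A) (hy : y ∈ A) (S T : Finset α) :
    momentMatrix A ((Equiv.swap x y).finsetCongr S) ((Equiv.swap x y).finsetCongr T) =
      momentMatrix A S T := by
  simp only [momentMatrix, of_apply, finsetCongr_swap_subset_iff hx hy, symmDiff_finsetCongr,
    card_finsetCongr]

variable [Fintype α]

theorem dotProduct_momentMatrix (A : Finset α) (w : Finset α → ℝ) :
    w ⬝ᵥ momentMatrix A *ᵥ w = ∑ S ∈ A.powerset, lowPart A w S *
      ∑ T ∈ A.powerset, lowPart A w T * a #A #(symmDiff S T) := by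
  have h (f : Finset α → ℝ) : ∑ S ∈ A.powerset, f S = ∑ S, if S ⊆ A then f S else 0 := by
    rw [← sum_filter]
    congr 1
    ext; simp
  simp only [h, dotProduct, mulVec, momentMatrix, of_apply, mul_sum, lowPart]
  refine sum_congr rfl fun S _ => ?_
  by_cases hS : S ⊆ A <;> by_cases hS' : 2 * #S ≤ #A <;> simp [hS, hS']
  refine sum_congr rfl fun T _ => ?_
  by_cases hT : T ⊆ A <;> simp [hT, mul_comm]

/-- Symmetric polynomials are constants modulo `e_1`, so the form is a square on them. -/
theorem momentMatrix_nonneg_of_invariant {A : Finset α} {w : Finset α → ℝ}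
    (hw : ∀ x ∈ A, ∀ y ∈ A, ∀ S, w ((Equiv.swap x y).finsetCongr S) = w S) :
    0 ≤ w ⬝ᵥ momentMatrix A *ᵥ w := by
  have hlow : ∀ k, ∃ c : ℝ, ∀ S ∈ A.powersetCard k, lowPart A w S = c := by
    intro k
    by_cases h : ∃ S, S ∈ A.powersetCard k
    · obtain ⟨S, hS⟩ := h
      rw [mem_powersetCard] at hS
      refine ⟨lowPart A w S, fun T hT => ?_⟩
      rw [mem_powersetCard] at hT
      rw [lowPart, lowPart, hT.2, hS.2,
        eq_of_card_eq_of_swap_invariant hw hT.1 hS.1 (hT.2.trans hS.2.symm)]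
    · exact ⟨0, fun S hS => absurd ⟨S, hS⟩ h⟩
  choose c hc using hlow
  have hc0 : ∀ k ≤ #A, #A < 2 * k → c k = 0 := by
    intro k hk hk'
    obtain ⟨S, hSA, hSk⟩ := exists_subset_card_eq hk
    rw [← hc k S (mem_powersetCard.2 ⟨hSA, hSk⟩), lowPart, if_neg (by omega)]
  -- `κ` is the constant to which the symmetric polynomial with coefficients `w` reduces.
  set κ : ℝ := ∑ k ∈ range (#A + 1), c k * esymmMoment A k ∅ with hκ
  have key : ∀ T ∈ A.powerset, 2 * #T ≤ #A →
      ∑ S ∈ A.powerset, lowPart A w S * a #A #(symmDiff T S) = κ * a #A #T := by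
    intro T hT hTc
    rw [sum_powerset, hκ, sum_mul]
    refine sum_congr rfl fun k hk => ?_
    have hk : k ≤ #A := by simpa [Nat.lt_succ_iff] using hk
    rw [sum_congr rfl fun S hS => by rw [hc k S hS, symmDiff_comm], ← mul_sum, mul_assoc]
    by_cases hk' : #A < 2 * k
    · rw [hc0 k hk hk', zero_mul, zero_mul]
    · rw [← esymmMoment_eq (mem_powerset.1 hT) (by omega), esymmMoment]
  have hsum : ∑ S ∈ A.powerset, lowPart A w S * a #A #S = κ := by
    have := key ∅ (empty_mem_powerset A) (by simp)
    simpa [a_zero, symmDiff_def] using this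
  rw [dotProduct_momentMatrix]
  have : ∑ S ∈ A.powerset, lowPart A w S *
      ∑ T ∈ A.powerset, lowPart A w T * a #A #(symmDiff S T) = κ * κ := by
    conv_rhs => rw [← hsum, sum_mul]
    refine sum_congr rfl fun S hS => ?_
    by_cases hS' : 2 * #S ≤ #A
    · rw [key S hS hS', hsum]; ring
    · simp [lowPart, hS']
  rw [this]
  exact mul_self_nonneg κ

/-- The vector `w - w ∘ σ`, with `σ` exchanging `x` and `y`, represents `(x - y) g` with `g` of
degree at most `#B / 2` in the variables of `B`. Since `(x - y)² = 2 (1 - x y)` on the hypercube,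
its form is a positive multiple of the form of `g` for `B`. -/
theorem momentMatrix_nonneg_of_antisymm {B : Finset α} {x y : α} (hx : x ∉ insert y B)
    (hy : y ∉ B) (hB : (momentMatrix B).PosSemidef) (w : Finset α → ℝ) :
    0 ≤ (w - w ∘ (Equiv.swap x y).finsetCongr) ⬝ᵥ momentMatrix (insert x (insert y B)) *ᵥ
      (w - w ∘ (Equiv.swap x y).finsetCongr) := by
  set u : Finset α → ℝ := w - w ∘ (Equiv.swap x y).finsetCongr with hu
  set A := insert x (insert y B) with hA
  have hxB : x ∉ B := fun h => hx (mem_insert_of_mem h)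
  have hxy : x ≠ y := fun h => hx (h ▸ mem_insert_self _ _)
  have hcard : #A = #B + 2 := by rw [hA, card_insert_of_notMem hx, card_insert_of_notMem hy]
  have hswap : ∀ S ⊆ B, ∀ z ∈ S, Equiv.swap x y z = z := fun S hS z hz =>
    Equiv.swap_apply_of_ne_of_ne (fun h => hxB (h ▸ hS hz)) (fun h => hy (h ▸ hS hz))
  have hfix : ∀ S ⊆ B, (Equiv.swap x y).finsetCongr S = S := by
    intro S hS
    rw [Equiv.finsetCongr_apply, map_eq_image]
    exact (image_congr (hswap S hS)).trans image_id
  have hins : ∀ z S, (Equiv.swap x y).finsetCongr (insert z S) =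
      insert (Equiv.swap x y z) ((Equiv.swap x y).finsetCongr S) := by
    intro z S
    simp [Equiv.finsetCongr_apply, map_insert]
  have hc0 : ∀ S ⊆ B, lowPart A u S = 0 := by
    intro S hS
    simp [lowPart, hu, hfix S hS]
  have hc2 : ∀ S ⊆ B, lowPart A u (insert x (insert y S)) = 0 := by
    intro S hS
    simp [lowPart, hu, hfix S hS, hins, insert_comm y x S]
  have hc1 : ∀ S ⊆ B, lowPart A u (insert y S) = -lowPart A u (insert x S) := by
    intro S hS
    have h1 : #(insert y S) = #(insert x S) := by
      rw [card_insert_of_notMem fun h => hy (hS h), card_insert_of_notMem fun h => hxB (hS h)]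
    simp only [lowPart, h1, hu, Pi.sub_apply, Function.comp, hfix S hS, hins,
      Equiv.swap_apply_left, Equiv.swap_apply_right]
    split_ifs <;> ring
  -- Multiplication by `x` raises the degree by one, and `#A / 2 = #B / 2 + 1`.
  have hlow : ∀ S ⊆ B, lowPart A u (insert x S) = lowPart B (fun S => u (insert x S)) S := by
    intro S hS
    simp only [lowPart, hcard, card_insert_of_notMem fun h => hxB (hS h)]
    exact if_congr (by omega) rfl rfl
  have hsame : ∀ z, ∀ S T : Finset α, z ∉ S → z ∉ T →
      symmDiff (insert z S) (insert z T) = symmDiff S T := by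
    intro z S T h1 h2
    ext v
    simp only [mem_symmDiff, mem_insert]
    grind
  have hdiff : ∀ S T : Finset α, S ⊆ B → T ⊆ B → ∀ z z', z ≠ z' → z ∉ B → z' ∉ B →
      #(symmDiff (insert z S) (insert z' T)) = #(symmDiff S T) + 2 := by
    intro S T hS hT z z' hz h1 h2
    have hd : symmDiff (insert z S) (insert z' T) = insert z (insert z' (symmDiff S T)) := by
      have := fun h => h1 (hS h)
      have := fun h => h1 (hT h)
      have := fun h => h2 (hS h)
      have := fun h => h2 (hT h)
      ext v
      simp only [mem_symmDiff, mem_insert]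
      grind
    have hsub : symmDiff S T ⊆ B :=
      (symmDiff_le_sup (a := S) (b := T)).trans (union_subset hS hT)
    rw [hd, card_insert_of_notMem, card_insert_of_notMem fun h => h2 (hsub h)]
    rw [mem_insert]
    rintro (h | h)
    exacts [hz h, h1 (hsub h)]
  have hmain : u ⬝ᵥ momentMatrix A *ᵥ u = 2 * (((#B : ℝ) + 2) / ((#B : ℝ) + 1)) *
      ((fun S => u (insert x S)) ⬝ᵥ momentMatrix B *ᵥ fun S => u (insert x S)) := by
    rw [dotProduct_momentMatrix, dotProduct_momentMatrix, hA,
      sum_powerset_mul_of_antisymm hx hy hc0 hc2 hc1, mul_sum]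
    refine sum_congr rfl fun S hS => ?_
    rw [mem_powerset] at hS
    rw [← hA, hlow S hS, ← sum_sub_distrib]
    simp only [← mul_sub]
    rw [hA, sum_powerset_mul_of_antisymm hx hy hc0 hc2 hc1, ← hA, mul_left_comm (2 * _)]
    congr 1
    rw [mul_sum]
    refine sum_congr rfl fun T hT => ?_
    rw [mem_powerset] at hT
    rw [hlow T hT, hsame x S T (fun h => hxB (hS h)) (fun h => hxB (hT h)),
      hsame y S T (fun h => hy (hS h)) (fun h => hy (hT h)), hdiff S T hS hT x y hxy hxB hy,
      hdiff S T hS hT y x hxy.symm hy hxB, hcard]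
    have hle : #(symmDiff S T) ≤ #B :=
      card_le_card ((symmDiff_le_sup (a := S) (b := T)).trans (union_subset hS hT))
    linear_combination 2 * lowPart B (fun S => u (insert x S)) T * a_sub_a_add_two hle
  rw [hmain]
  have := hB.dotProduct_mulVec_nonneg (fun S => u (insert x S))
  rw [star_trivial] at this
  positivity

/-- The pseudomoment matrix of any finite set of variables is positive semidefinite: a transposition
`σ` reduces the form on the vectors `w - w ∘ σ` to the variables that `σ` does not move, and the
vectors invariant under all transpositions are symmetric polynomials. -/
theorem momentMatrix_posSemidef (A : Finset α) : (momentMatrix A).PosSemidef := by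
  induction A using Finset.strongInduction with
  | H A ih =>
    refine posSemidef_of_perm (momentMatrix_isHermitian A)
      {τ | ∃ x ∈ A, ∃ y ∈ A, x ≠ y ∧ τ = (Equiv.swap x y).finsetCongr} ?_ ?_ ?_
    · rintro _ ⟨x, hx, y, hy, -, rfl⟩ S T
      exact momentMatrix_swap hx hy S T
    · rintro w _ ⟨x, hx, y, hy, hxy, rfl⟩
      have hA : A = insert x (insert y ((A.erase x).erase y)) := by
        rw [insert_erase (mem_erase.2 ⟨hxy.symm, hy⟩), insert_erase hx]
      have hss : (A.erase x).erase y ⊂ A :=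
        (erase_subset _ _).trans_ssubset (erase_ssubset hx)
      have := momentMatrix_nonneg_of_antisymm (x := x) (y := y) (B := (A.erase x).erase y)
        (by simp [hxy]) (by simp) (ih _ hss) w
      rwa [← hA] at this
    · intro w hw
      refine momentMatrix_nonneg_of_invariant fun x hx y hy S => ?_
      by_cases hxy : x = y
      · subst hxy
        simp
      · exact congrFun (hw _ ⟨x, hx, y, hy, hxy, rfl⟩) S

end MomentMatrix

theorem Y_posSemidef (n : ℕ) : (Y n).PosSemidef := by
  have h : Y n = (momentMatrix (univ : Finset (Fin n))).submatrix Subtype.val Subtype.val := by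
    ext S T
    have hS : 2 * #S.1 ≤ n := by have := S.2; unfold dMax at this; omega
    have hT : 2 * #T.1 ≤ n := by have := T.2; unfold dMax at this; omega
    simp [Y, momentMatrix, hS, hT]
  rw [h]
  exact (momentMatrix_posSemidef _).submatrix _

/-! ### The pseudoexpectation for odd `n` -/

section Functional

variable {n : ℕ}

/-- The variables with an odd exponent: `x^m` agrees with the product of these variables on the
hypercube. -/
def oddSupport (m : Fin n →₀ ℕ) : Finset (Fin n) := {i | Odd (m i)}

theorem oddSupport_add (m m' : Fin n →₀ ℕ) :
    oddSupport (m + m') = symmDiff (oddSupport m) (oddSupport m') := by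
  ext i
  simp only [oddSupport, mem_symmDiff, mem_filter, mem_univ, true_and, Finsupp.add_apply,
    Nat.odd_add, ← Nat.not_odd_iff_even]
  tauto

theorem oddSupport_single_two (i : Fin n) : oddSupport (Finsupp.single i 2) = ∅ := by
  ext j
  by_cases h : i = j <;> simp [oddSupport, Finsupp.single_apply, h]

theorem card_oddSupport_le (m : Fin n →₀ ℕ) : #(oddSupport m) ≤ m.degree := by
  rw [Finsupp.degree_eq_sum, card_eq_sum_ones]
  calc ∑ i ∈ oddSupport m, 1 ≤ ∑ i ∈ oddSupport m, m i :=
        sum_le_sum fun i hi => (mem_filter.1 hi).2.pos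
    _ ≤ ∑ i, m i := sum_le_sum_of_subset (subset_univ _)

/-- The functional `x^m ↦ a_{#{i | m_i odd}}` on all polynomials. -/
noncomputable def momentFunctional (n : ℕ) : MvPolynomial (Fin n) ℝ →ₗ[ℝ] ℝ :=
  (MvPolynomial.basisMonomials (Fin n) ℝ).constr ℝ fun m => a n #(oddSupport m)

theorem momentFunctional_monomial (m : Fin n →₀ ℕ) (r : ℝ) :
    momentFunctional n (MvPolynomial.monomial m r) = r * a n #(oddSupport m) := by
  have h : MvPolynomial.monomial m r = r • MvPolynomial.basisMonomials (Fin n) ℝ m := by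
    simp [MvPolynomial.smul_monomial]
  rw [h, map_smul, momentFunctional, Module.Basis.constr_basis, smul_eq_mul]

theorem momentFunctional_one : momentFunctional n 1 = 1 := by
  have h := momentFunctional_monomial (0 : Fin n →₀ ℕ) 1
  rw [← MvPolynomial.C_apply, MvPolynomial.C_1] at h
  simpa [oddSupport, a_zero] using h

theorem momentFunctional_constraint (i : Fin n) (p : MvPolynomial (Fin n) ℝ) :
    momentFunctional n ((MvPolynomial.X i ^ 2 - 1) * p) = 0 := by
  induction p using MvPolynomial.induction_on' with
  | monomial m r =>
    rw [sub_mul, one_mul, MvPolynomial.X_pow_eq_monomial, MvPolynomial.monomial_mul, one_mul,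
      map_sub, momentFunctional_monomial, momentFunctional_monomial, oddSupport_add,
      oddSupport_single_two]
    simp [symmDiff_def]
  | add p q hp hq => rw [mul_add, map_add, hp, hq, add_zero]

theorem mono_eq_monomial (S : Finset (Fin n)) :
    mono S = MvPolynomial.monomial (∑ i ∈ S, Finsupp.single i 1) (1 : ℝ) := by
  rw [mono, MvPolynomial.monomial_sum_one]
  rfl

theorem oddSupport_sum_single (S : Finset (Fin n)) :
    oddSupport (∑ i ∈ S, Finsupp.single i 1) = S := by
  ext j
  by_cases h : j ∈ S <;> simp [oddSupport, Finsupp.finsetSum_apply, Finsupp.single_apply, h]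

theorem momentFunctional_mono_mul_mono (S T : Finset (Fin n)) :
    momentFunctional n (mono S * mono T) = a n #(symmDiff S T) := by
  rw [mono_eq_monomial, mono_eq_monomial, MvPolynomial.monomial_mul, momentFunctional_monomial,
    oddSupport_add, oddSupport_sum_single, oddSupport_sum_single]
  simp

theorem momentFunctional_sq_nonneg {p : MvPolynomial (Fin n) ℝ} (hp : p.totalDegree ≤ dMax n) :
    0 ≤ momentFunctional n (p ^ 2) := by
  let f : p.support → SubsetLE n (dMax n) := fun m =>
    ⟨oddSupport m.1, (card_oddSupport_le m.1).trans ((MvPolynomial.le_totalDegree m.2).trans hp)⟩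
  have h := ((Y_posSemidef n).submatrix f).dotProduct_mulVec_nonneg fun m => p.coeff m.1
  refine h.trans_eq ?_
  have hp2 : p ^ 2 = ∑ m ∈ p.support, ∑ m' ∈ p.support,
      MvPolynomial.monomial (m + m') (p.coeff m * p.coeff m') := by
    conv_lhs => rw [pow_two, p.as_sum, sum_mul_sum]
    simp only [MvPolynomial.monomial_mul]
  rw [hp2]
  simp only [map_sum, momentFunctional_monomial, oddSupport_add, star_trivial, dotProduct, mulVec,
    mul_sum, submatrix_apply, Y, of_apply]
  rw [← sum_coe_sort p.support]
  refine sum_congr rfl fun m _ => ?_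
  rw [← sum_coe_sort p.support]
  refine sum_congr rfl fun m' _ => ?_
  simp only [f]
  ring

/-- The pseudoexpectation behaves as if the sum of the variables were zero. -/
theorem momentFunctional_sum_sq (hn : 2 ≤ n) :
    momentFunctional n ((∑ i, MvPolynomial.X i) ^ 2) = 0 := by
  have hX : ∀ i : Fin n, (MvPolynomial.X i : MvPolynomial (Fin n) ℝ) = mono {i} := by
    intro i; simp [mono]
  rw [pow_two, sum_mul_sum]
  simp only [map_sum, hX, momentFunctional_mono_mul_mono]
  refine sum_eq_zero fun i _ => ?_
  simp only [symmDiff_comm {i}]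
  have h := sum_comp_card_symmDiff_singleton (subset_univ {i}) (a n)
  rw [h]
  have := mul_a_pred_add_mul_a_succ (n := n) (k := 1) (by omega)
  simpa using this

/-- A sum of an odd number of signs is a nonzero integer, being odd. -/
theorem one_le_sq_sum_of_mem_hypercube (hn : Odd n) {x : Fin n → ℝ} (hx : x ∈ hypercube n) :
    1 ≤ (∑ i, x i) ^ 2 := by
  have hz : ∀ i, ∃ z : ℤ, 2 * (z : ℝ) + 1 = x i := by
    intro i
    rcases hx i with h | h
    · exact ⟨0, by simp [h]⟩
    · exact ⟨-1, by rw [h]; norm_num⟩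
  choose z hz using hz
  have h0 : 2 * (∑ i, z i) + n ≠ 0 := by
    obtain ⟨m, rfl⟩ := hn
    push_cast
    omega
  have h1 : (1 : ℤ) ≤ (2 * (∑ i, z i) + n) ^ 2 := by
    have := sq_pos_of_ne_zero h0
    omega
  have h2 : ∑ i, x i = ((2 * (∑ i, z i) + n : ℤ) : ℝ) := by
    simp [← hz, sum_add_distrib, mul_sum]
  rw [h2]
  exact_mod_cast h1

theorem finite_hypercube (n : ℕ) : (hypercube n).Finite := by
  refine (Set.Finite.pi' fun _ : Fin n => Set.toFinite ({1, -1} : Set ℝ)).subset ?_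
  intro x hx i
  simpa using hx i

theorem expectation_le {μ : MeasureTheory.Measure (hypercube n)}
    [MeasureTheory.IsProbabilityMeasure μ] {p : MvPolynomial (Fin n) ℝ} {c : ℝ}
    (h : ∀ x ∈ hypercube n, MvPolynomial.eval x p ≤ c) : expectation μ p ≤ c := by
  have : Finite (hypercube n) := finite_hypercube n
  calc expectation μ p ≤ ∫ _ : hypercube n, c ∂μ :=
        MeasureTheory.integral_mono .of_finite .of_finite fun x => h x.1 x.2
    _ = c := by simp

end Functional

end GrigorievLaurent

/-- For `n ≥ 2` the matrix `Y^(n)` is positive semidefinite; and for odd `n` (so `n ≥ 3` and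
`2 * d_max(n) = n - 1`) it is the pseudomoment matrix of a degree `n - 1` pseudoexpectation `E`
that is not the expectation under any probability measure on `{±1}^n`, and for which
`E[p] > max_{x ∈ {±1}^n} p(x)` for some polynomial `p` of degree at most `n - 1`. -/
theorem theorem2 (n : ℕ) (hn : 2 ≤ n) :
    (GrigorievLaurent.Y n).PosSemidef ∧
    (Odd n →
      ∃ E : GrigorievLaurent.PolyLE n (2 * GrigorievLaurent.dMax n) →ₗ[ℝ] ℝ,
        GrigorievLaurent.IsPseudoexpectation E ∧
        GrigorievLaurent.pseudomomentMatrix E = GrigorievLaurent.Y n ∧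
        (∀ μ : MeasureTheory.Measure (GrigorievLaurent.hypercube n),
          MeasureTheory.IsProbabilityMeasure μ →
          ¬ ∀ p : GrigorievLaurent.PolyLE n (2 * GrigorievLaurent.dMax n),
            E p = GrigorievLaurent.expectation μ p.1) ∧
        (∃ p : GrigorievLaurent.PolyLE n (2 * GrigorievLaurent.dMax n),
          ∀ x ∈ GrigorievLaurent.hypercube n, MvPolynomial.eval x p.1 < E p)) := by
  refine ⟨GrigorievLaurent.Y_posSemidef n, fun hodd => ?_⟩
  -- The separating polynomial is `-(x_1 + ⋯ + x_n)²`, of pseudoexpectation `0`.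
  set q : MvPolynomial (Fin n) ℝ := -(∑ i, MvPolynomial.X i) ^ 2 with hq
  have hdeg : q ∈ GrigorievLaurent.PolyLE n (2 * GrigorievLaurent.dMax n) := by
    refine neg_mem (GrigorievLaurent.sq_mem_polyLE _ ?_)
    refine MvPolynomial.totalDegree_finsetSum_le fun i _ => ?_
    rw [MvPolynomial.totalDegree_X]
    unfold GrigorievLaurent.dMax
    omega
  have hq0 : GrigorievLaurent.momentFunctional n q = 0 := by
    rw [hq, map_neg, GrigorievLaurent.momentFunctional_sum_sq hn, neg_zero]
  have hqx : ∀ x ∈ GrigorievLaurent.hypercube n, MvPolynomial.eval x q ≤ -1 := by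
    intro x hx
    have := GrigorievLaurent.one_le_sq_sum_of_mem_hypercube hodd hx
    simpa [hq] using this
  refine ⟨(GrigorievLaurent.momentFunctional n).domRestrict _, ⟨?_, ?_, ?_⟩, ?_, ?_, ⟨q, hdeg⟩, ?_⟩
  · exact GrigorievLaurent.momentFunctional_one
  · exact fun i p _ => GrigorievLaurent.momentFunctional_constraint i p
  · exact fun p hp => GrigorievLaurent.momentFunctional_sq_nonneg hp
  · ext S T
    exact GrigorievLaurent.momentFunctional_mono_mul_mono S.1 T.1
  · intro μ hμ h
    have h1 : GrigorievLaurent.momentFunctional n q = GrigorievLaurent.expectation μ q :=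
      h ⟨q, hdeg⟩
    have h2 := GrigorievLaurent.expectation_le (μ := μ) hqx
    linarith
  · intro x hx
    have h1 := hqx x hx
    change MvPolynomial.eval x q < GrigorievLaurent.momentFunctional n q
    linarith
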